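/- **Finite convergence of DiPOA with second-order cuts.** *Setting.* Let $f_1,\dots,f_N:\mathbb R^n\to\mathbb R$ be twice differentiable with $\nabla^2 f_i(x)\succeq m_i I$ for all $x$, where $m_i>0$; let $g_1,\dots,g_m:\mathbb R^n\to\mathbb R$ be convex and continuously differentiable; let $\Omega=\{x: Dx\le d,\ Ax=b\}$ be bounded, $\kappa\in\mathbb N$, and let $\mathcal E_1,\dots,\mathcal E_K\subseteq\{1,\dots,N\}$ be nonempty hyperedges. Put $\mathcal X=\{x\in\Omega: g_h(x)\le 0\ \forall h\}$. The sparse convex program (SCP) is to minimize $\sum_i f_i(x)$ over $x\in\mathcal X$ with $\|x\|_0\le\kappa$. Its consensus form is $$P_2:\quad \min_{\tilde x,\tilde y}\ \sum_{i} f_i(x_i)\quad\text{s.t. } x_i\in\mathcal X\ \forall i,\quad x_i=y_j\ \forall i\in\mathcal E_j,\ \forall j,\quad \|y_j\|_0\le\kappa\ \forall j .$$ Let $M_j$ be so large that $\|x\|_\infty\le M_j$ for all $x\in\Omega$. For $z=(z_1,\dots,z_K)$ with $z_j\in\{0,1\}^n$ let $L(z)$ be the set of $(\tilde x,\tilde y)$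 with $x_i\in\Omega$ for all $i$, $x_i=y_j$ for $i\in\mathcal E_j$, and $-M_jz_j\le y_j\le M_jz_j$ for all $j$; the primal problem $P_7(z)$ is to minimize $\sum_i f_i(x_i)$ over $(\tilde x,\tilde y)\in L(z)$ with $g_h(x_i)\le0$ for all $i,h$. Assume that for every $z$ with $\sum_l z_{j,l}\le\kappa$ for all $j$, Abadie's constraint qualification (every direction of the linearized cone is tangent to the feasible set) holds for $P_7(z)$ at its optimal solutions. *Algorithm.* Start from $z^0$ with $\sum_l z^0_{j,l}\le\kappa$ for all $j$ and with $P_7(z^0)$ feasible. In iteration $k=1,2,\dots$: (a) if $P_7(z^{k-1})$ is feasible, let $(\tilde x^k,\tilde y^k)$ be an optimal solution of it; otherwise let it be either a minimizer of $\sum_{i,h}g_h(x_i)$ over $L(z^{k-1})$ whose value is positive, or a minimizer of $\sum_{i,h}\max\{g_h(x_i),0\}$ over $L(z^{k-1})$; (b) let $(\alpha^{(k)},\tilde x^{(k)},\tilde y^{(k)},z^k)$ be an optimal solution of the master problem $$\text{MIQCP}_k:\quad \min\ \sum_i\alpha_i\quad\text{s.t. } (\tilde x,\tilde y)\in L(z),\quad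 z_j\in\{0,1\}^n,\quad \textstyle\sum_l z_{j,l}\le\kappa\ \forall j,$$ and, for all $\ell=1,\dots,k$: - $\alpha_i\ge f_i(x_i^\ell)+\nabla f_i(x_i^\ell)^T(x_i-x_i^\ell)+\frac{m_i}{2}\|x_i-x_i^\ell\|_2^2$ for all $i$ with $x_i^\ell\in\mathcal X$; - $0\ge\nabla g_h(x_i^\ell)^T(x_i-x_i^\ell)$ for all $i$ with $x_i^\ell\in\mathcal X\cap\partial\mathcal X$ and all $h$ with $g_h(x_i^\ell)=0$; - if some $x_i^\ell\notin\mathcal X$: $g_h(x_i^\ell)+\nabla g_h(x_i^\ell)^T(x_i-x_i^\ell)\le0$ for all $i,h$. *Claim.* 1. For all $i$ and all $c,x\in\mathbb R^n$: $f_i(x)\ge f_i(c)+\nabla f_i(c)^T(x-c)+\frac{m_i}{2}\|x-c\|_2^2$. 2. No feasible point is cut off, whatever the points at which the cuts are generated: for every feasible $(\tilde x,\tilde y)$ of $P_2$ there is a $z$ such that $((f_i(x_i))_i,\tilde x,\tilde y,z)$ is feasible for $\text{MIQCP}_k$ for every $k$. The same holds for $x_i=y_j=x$ with any feasible $x$ of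 the SCP. 3. For every run of the algorithm there is a $k^*$ such that for all $k\ge k^*$ the optimal solution of $\text{MIQCP}_k$ computed in the run solves $P_2$, that is, $(\tilde x^{(k)},\tilde y^{(k)})$ is an optimal solution of $P_2$ and $\alpha^{(k)}_i=f_i(x^{(k)}_i)$ for all $i$ (so the optimal values agree); and, conversely, for every optimal solution $(\tilde x,\tilde y)$ of $P_2$ there is a $z$ such that $((f_i(x_i))_i,\tilde x,\tilde y,z)$ is an optimal solution of $\text{MIQCP}_k$. -/

import Mathlib

open scoped Matrix

namespace DiPOA

/-- `f` is twice differentiable on `ℝⁿ`, `m > 0`, and its Hessian satisfies `∇²f(x) ⪰ m I`. -/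
def IsStronglyConvex {n : ℕ} (m : ℝ) (f : EuclideanSpace ℝ (Fin n) → ℝ) : Prop :=
  0 < m ∧ Differentiable ℝ f ∧ Differentiable ℝ (fderiv ℝ f) ∧
    ∀ x v, m * ‖v‖ ^ 2 ≤ fderiv ℝ (fderiv ℝ f) x v v

/-- The data of a sparse convex program distributed over a hypergraph: `N` nodes, `K` hyperedges,
`n` variables, `H` nonlinear constraints, `p` linear inequalities and `q` linear equations. -/
structure Problem (N K n H p q : ℕ) where
  /-- local objectives -/
  f : Fin N → EuclideanSpace ℝ (Fin n) → ℝ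
  /-- strong convexity parameters used in the quadratic cuts -/
  μ : Fin N → ℝ
  /-- nonlinear constraints -/
  g : Fin H → EuclideanSpace ℝ (Fin n) → ℝ
  /-- matrix of the linear inequalities -/
  D : Matrix (Fin p) (Fin n) ℝ
  /-- right-hand side of the linear inequalities -/
  d : Fin p → ℝ
  /-- matrix of the linear equations -/
  A : Matrix (Fin q) (Fin n) ℝ
  /-- right-hand side of the linear equations -/
  b : Fin q → ℝ
  /-- hyperedges -/
  E : Fin K → Finset (Fin N)
  /-- sparsity level -/
  κ : ℕ
  /-- big-M constants -/
  M : Fin K → ℝ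

/-- A pair `(x̃, ỹ)`: one copy `x i` per node and one auxiliary vector `y j` per hyperedge. -/
abbrev Point (N K n : ℕ) : Type :=
  (Fin N → EuclideanSpace ℝ (Fin n)) × (Fin K → EuclideanSpace ℝ (Fin n))

/-- Binary vectors `z_1, …, z_K ∈ {0,1}ⁿ`. -/
abbrev Binary (K n : ℕ) : Type := Fin K → Fin n → Bool

/-- The variables `(α, x̃, ỹ, z̃)` of the master problem. -/
structure MasterPoint (N K n : ℕ) where
  /-- epigraph variables -/
  α : Fin N → ℝ
  /-- the pair `(x̃, ỹ)` -/
  pt : Point N K n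
  /-- the binary variables -/
  z : Binary K n

/-- `a` is an optimal solution of `min F` over the feasible set `S`. -/
def IsOptimal {β : Type*} (F : β → ℝ) (S : Set β) (a : β) : Prop :=
  a ∈ S ∧ IsMinOn F S a

/-- The number of nonzero entries of a vector. -/
noncomputable def l0 {n : ℕ} (x : EuclideanSpace ℝ (Fin n)) : ℕ :=
  (Finset.univ.filter fun l => x l ≠ 0).card

namespace Problem

variable {N K n H p q : ℕ} (P : Problem N K n H p q)

/-- The polyhedron `Ω = {x : D x ≤ d, A x = b}`. -/
def Ω : Set (EuclideanSpace ℝ (Fin n)) :=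
  {x | (∀ r, (P.D *ᵥ x.ofLp) r ≤ P.d r) ∧ P.A *ᵥ x.ofLp = P.b}

/-- The set `X = {x ∈ Ω : g(x) ≤ 0}`. -/
def X : Set (EuclideanSpace ℝ (Fin n)) := {x | x ∈ P.Ω ∧ ∀ h, P.g h x ≤ 0}

/-- The feasible set of the sparse convex program in the single global variable `x`. -/
def scpFeasible : Set (EuclideanSpace ℝ (Fin n)) := {x | x ∈ P.X ∧ l0 x ≤ P.κ}

/-- The objective `∑ i, f_i(x_i)`. -/
def objective (w : Point N K n) : ℝ := ∑ i, P.f i (w.1 i)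

/-- The consensus constraints `x_i = y_j` for `i ∈ E_j`. -/
def Consensus (w : Point N K n) : Prop := ∀ j, ∀ i ∈ P.E j, w.1 i = w.2 j

/-- The feasible set of the consensus form (problem `P₂`) of the sparse convex program. -/
def consensusFeasible : Set (Point N K n) :=
  {w | (∀ i h, P.g h (w.1 i) ≤ 0) ∧ P.Consensus w ∧ (∀ i, w.1 i ∈ P.Ω) ∧
    ∀ j, l0 (w.2 j) ≤ P.κ}

/-- `z_j` has at most `κ` ones for every `j`. -/
def CardOK (z : Binary K n) : Prop := ∀ j, ∑ l, (z j l).toNat ≤ P.κ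

/-- The linear constraints on `(x̃, ỹ)` for fixed binary vectors: consensus, `x_i ∈ Ω`, and
`-M_j z_j ≤ y_j ≤ M_j z_j`. -/
def linearFeasible (z : Binary K n) : Set (Point N K n) :=
  {w | P.Consensus w ∧ (∀ i, w.1 i ∈ P.Ω) ∧
    ∀ j l, -(P.M j * ((z j l).toNat : ℝ)) ≤ w.2 j l ∧ w.2 j l ≤ P.M j * ((z j l).toNat : ℝ)}

/-- The feasible set of the primal problem for fixed binary vectors; its objective is
`P.objective`. -/
def primalFeasible (z : Binary K n) : Set (Point N K n) :=
  {w | w ∈ P.linearFeasible z ∧ ∀ i h, P.g h (w.1 i) ≤ 0}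

/-- The linearized cone of the primal problem at `w`: the directions `(u, v)` that satisfy to first
order every equation and every inequality active at `w`. -/
def linearizedCone (z : Binary K n) (w : Point N K n) : Set (Point N K n) :=
  {e | (∀ i h, P.g h (w.1 i) = 0 → inner ℝ (gradient (P.g h) (w.1 i)) (e.1 i) ≤ 0) ∧
    P.Consensus e ∧
    (∀ i r, (P.D *ᵥ (w.1 i).ofLp) r = P.d r → (P.D *ᵥ (e.1 i).ofLp) r ≤ 0) ∧
    (∀ i, P.A *ᵥ (e.1 i).ofLp = 0) ∧
    ∀ j l, (w.2 j l = P.M j * ((z j l).toNat : ℝ) → e.2 j l ≤ 0) ∧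
      (w.2 j l = -(P.M j * ((z j l).toNat : ℝ)) → 0 ≤ e.2 j l)}

/-- Abadie's constraint qualification for the primal problem at `w`: every linearized direction is
tangent to the feasible set. -/
def ConstraintQualification (z : Binary K n) (w : Point N K n) : Prop :=
  P.linearizedCone z w ⊆ posTangentConeAt (P.primalFeasible z) w

/-- `w` is a point at which feasibility cuts are generated when the primal problem for `z` is
infeasible. It minimizes over the linear constraints either the sum of the `g_h(x_i)`, with a
positive minimum (a certificate of infeasibility), or the sum of the constraint violations. -/
def IsInfeasibilityPoint (z : Binary K n) (w : Point N K n) : Prop :=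
  (IsOptimal (fun w' : Point N K n => ∑ i, ∑ h, P.g h (w'.1 i)) (P.linearFeasible z) w ∧
      0 < ∑ i, ∑ h, P.g h (w.1 i)) ∨
    IsOptimal (fun w' : Point N K n => ∑ i, ∑ h, max (P.g h (w'.1 i)) 0) (P.linearFeasible z) w

/-- The right-hand side of the quadratic cut for `f_i` at `c`, evaluated at `x`. -/
noncomputable def soCut (i : Fin N) (c x : EuclideanSpace ℝ (Fin n)) : ℝ :=
  P.f i c + inner ℝ (gradient (P.f i) c) (x - c) + P.μ i / 2 * ‖x - c‖ ^ 2

/-- The cuts generated at the point `c = (x_1^ℓ, …, x_N^ℓ)`: quadratic cuts for the objectives at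
feasible `x_i^ℓ`; linear cuts for the active constraints at feasible `x_i^ℓ` on the boundary; and
feasibility cuts for all constraints if some `x_i^ℓ` is infeasible. -/
def SatisfiesCuts (c : Fin N → EuclideanSpace ℝ (Fin n)) (s : MasterPoint N K n) : Prop :=
  (∀ i, c i ∈ P.X → P.soCut i (c i) (s.pt.1 i) ≤ s.α i) ∧
  (∀ i h, c i ∈ P.X → c i ∈ frontier P.X → P.g h (c i) = 0 →
    inner ℝ (gradient (P.g h) (c i)) (s.pt.1 i - c i) ≤ 0) ∧
  ((∃ i, c i ∉ P.X) → ∀ i h,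
    P.g h (c i) + inner ℝ (gradient (P.g h) (c i)) (s.pt.1 i - c i) ≤ 0)

/-- The feasible set of the master problem at iteration `k`, with the cuts generated at the points
of the iterations `1, …, k`. -/
def masterFeasible (w : ℕ → Point N K n) (k : ℕ) : Set (MasterPoint N K n) :=
  {s | (∀ ℓ ∈ Finset.Icc 1 k, P.SatisfiesCuts (w ℓ).1 s) ∧ s.pt ∈ P.linearFeasible s.z ∧
    P.CardOK s.z}

/-- `s` is an optimal solution of the master problem `min ∑ i, α_i` at iteration `k`. -/
def IsMasterOptimal (w : ℕ → Point N K n) (k : ℕ) (s : MasterPoint N K n) : Prop :=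
  IsOptimal (fun s' : MasterPoint N K n => ∑ i, s'.α i) (P.masterFeasible w k) s

/-- The master point obtained from `(x̃, ỹ)` with `α_i = f_i(x_i)` and the binary vectors `z`. -/
def lift (w : Point N K n) (z : Binary K n) : MasterPoint N K n :=
  ⟨fun i => P.f i (w.1 i), w, z⟩

/-- A run of the algorithm from feasible binary vectors `z⁰`, without stopping rule: iteration
`k ≥ 1` solves the primal problem for `z^{k-1}` (or computes an infeasibility point if it has no
feasible point), which gives `w k`, adds the cuts at `w k`, and then solves the master problem,
which gives `s k` and its binary part `z^k`. The values `w 0` and `s 0` are not used. -/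
structure IsRun (z : ℕ → Binary K n) (w : ℕ → Point N K n) (s : ℕ → MasterPoint N K n) :
    Prop where
  card_init : P.CardOK (z 0)
  feasible_init : (P.primalFeasible (z 0)).Nonempty
  primal : ∀ k, (P.primalFeasible (z k)).Nonempty →
    IsOptimal P.objective (P.primalFeasible (z k)) (w (k + 1))
  infeasible : ∀ k, ¬ (P.primalFeasible (z k)).Nonempty → P.IsInfeasibilityPoint (z k) (w (k + 1))
  master : ∀ k, P.IsMasterOptimal w (k + 1) (s (k + 1))
  binary : ∀ k, z (k + 1) = (s (k + 1)).z

end Problem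

end DiPOA

/-! Each cut is a global underestimator, so every master problem is a relaxation of `P₂`.
Conversely, let `w` solve the primal problem for `z`, and let `(α, x)` satisfy the cuts at `w` and
the linear constraints for `z`. Then `x - w` lies in the linearized cone, hence by Abadie's
condition it is tangent to the primal feasible set and the objective does not decrease along it to
first order; the quadratic cuts therefore give `∑ α_i ≥ ∑ f_i(w_i) + ∑ μ_i / 2 ‖x_i - w_i‖²`. An
infeasibility point for `z`, in turn, cuts off all of `L(z)`, since moving towards a point that
satisfies the linearized constraints would decrease the infeasibility measure it minimizes.

There are finitely many `z`, so from some iteration on the master problem only returns a `z` that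
has already been explored. Then the lower bound on the master value is attained, which forces the
master solution to be `w` with `α_i = f_i(w_i)`. -/

namespace DiPOA

open Filter Topology

section Calculus

variable {F : Type*} [NormedAddCommGroup F] [NormedSpace ℝ F]

lemma add_hasFDerivAt_le_of_convexOn {S : Set F} {f : F → ℝ} {f' : F →L[ℝ] ℝ} {c x : F}
    (hf : ConvexOn ℝ S f) (hc : c ∈ S) (hx : x ∈ S) (hf' : HasFDerivAt f f' c) :
    f c + f' (x - c) ≤ f x := by
  have hline : ConvexOn ℝ (AffineMap.lineMap c x ⁻¹' S) (f ∘ AffineMap.lineMap (k := ℝ) c x) :=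
    hf.comp_affineMap _
  have hderiv : HasDerivAt (f ∘ AffineMap.lineMap (k := ℝ) c x) (f' (x - c)) 0 :=
    HasFDerivAt.comp_hasDerivAt 0 (by simpa using hf') AffineMap.hasDerivAt_lineMap
  have hslope := hline.le_slope_of_hasDerivAt (x := 0) (y := 1)
    (by simpa using hc) (by simpa using hx) zero_lt_one hderiv
  simpa [slope_def_field, le_sub_iff_add_le'] using hslope

lemma add_fderiv_add_sq_le_of_le_fderiv_fderiv {f : F → ℝ} {m : ℝ} (hf : Differentiable ℝ f)
    (hf' : Differentiable ℝ (fderiv ℝ f))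
    (hm : ∀ x v, m * ‖v‖ ^ 2 ≤ fderiv ℝ (fderiv ℝ f) x v v) (c x : F) :
    f c + fderiv ℝ f c (x - c) + m / 2 * ‖x - c‖ ^ 2 ≤ f x := by
  let γ : ℝ → F := AffineMap.lineMap c x
  let φ : ℝ → ℝ := fun t => f (γ t) - m / 2 * ‖x - c‖ ^ 2 * t ^ 2
  have hγ (t : ℝ) : HasDerivAt γ (x - c) t := AffineMap.hasDerivAt_lineMap
  have hφ (t : ℝ) : HasDerivAt φ (fderiv ℝ f (γ t) (x - c) - m * ‖x - c‖ ^ 2 * t) t :=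
    (((hf (γ t)).hasFDerivAt.comp_hasDerivAt t (hγ t)).sub
      ((hasDerivAt_pow 2 t).const_mul (m / 2 * ‖x - c‖ ^ 2))).congr_deriv (by norm_num; ring)
  have hφ' (t : ℝ) : HasDerivAt (fun t => fderiv ℝ f (γ t) (x - c) - m * ‖x - c‖ ^ 2 * t)
      (fderiv ℝ (fderiv ℝ f) (γ t) (x - c) (x - c) - m * ‖x - c‖ ^ 2) t :=
    ((((hf' (γ t)).hasFDerivAt.comp_hasDerivAt t (hγ t)).clm_apply
      (hasDerivAt_const t (x - c))).sub
      ((hasDerivAt_id t).const_mul (m * ‖x - c‖ ^ 2))).congr_deriv (by simp)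
  have hconv : ConvexOn ℝ Set.univ φ :=
    convexOn_of_hasDerivWithinAt2_nonneg convex_univ
      (fun t _ => (hφ t).continuousAt.continuousWithinAt) (fun t _ => (hφ t).hasDerivWithinAt)
      (fun t _ => (hφ' t).hasDerivWithinAt) fun t _ => sub_nonneg.2 (hm _ _)
  have htangent := add_hasFDerivAt_le_of_convexOn hconv (Set.mem_univ 0) (Set.mem_univ 1)
    (hφ 0).hasFDerivAt
  simp only [φ, γ, AffineMap.lineMap_apply_zero, AffineMap.lineMap_apply_one, sub_zero,
    ContinuousLinearMap.toSpanSingleton_apply, one_smul, mul_zero] at htangent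
  linarith

lemma fderiv_eq_zero_of_nonpos_of_mem_interior {S : Set F} {g : F → ℝ} {x : F}
    (hg : ∀ u ∈ S, g u ≤ 0) (hx : x ∈ interior S) (h0 : g x = 0) : fderiv ℝ g x = 0 := by
  have hmax : IsLocalMax g x := by
    filter_upwards [mem_interior_iff_mem_nhds.1 hx] with u hu
    exact h0 ▸ hg u hu
  exact hmax.fderiv_eq_zero

lemma eventually_le_one_sub_mul_add {φ : ℝ → ℝ} {φ' ε : ℝ} (hφ : HasDerivAt φ φ' 0)
    (hneg : φ 0 + φ' ≤ 0) (hε : 0 < ε) : ∀ᶠ t in 𝓝[>] 0, φ t ≤ (1 - t) * φ 0 + t * ε := by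
  have hslope := (hasDerivAt_iff_tendsto_slope.1 hφ).mono_left
    (nhdsWithin_mono 0 fun t (ht : 0 < t) => ht.ne')
  filter_upwards [hslope.eventually_lt_const (show φ' < -φ 0 + ε by linarith),
    self_mem_nhdsWithin] with t ht (ht0 : 0 < t)
  rw [slope_def_field, sub_zero, div_lt_iff₀ ht0] at ht
  linarith

lemma exists_sum_comp_lt {ι : Type*} [Fintype ι] {ψ : ℝ → ℝ} (hmono : Monotone ψ)
    (hconv : ConvexOn ℝ Set.univ ψ) (hψ0 : ψ 0 ≤ 0) {φ : ι → ℝ → ℝ} {φ' : ι → ℝ}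
    (hφ : ∀ a, HasDerivAt (φ a) (φ' a) 0) (hneg : ∀ a, φ a 0 + φ' a ≤ 0)
    (hpos : 0 < ∑ a, ψ (φ a 0)) :
    ∃ t ∈ Set.Ioo (0 : ℝ) 1, ∑ a, ψ (φ a t) < ∑ a, ψ (φ a 0) := by
  have hψ : Continuous ψ := continuousOn_univ.1 (hconv.continuousOn isOpen_univ)
  obtain ⟨ε, hε, hε0⟩ : ∃ ε, ∑ _a : ι, ψ ε < ∑ a, ψ (φ a 0) ∧ 0 < ε := by
    have hlim : ContinuousAt (fun ε => ∑ _a : ι, ψ ε) 0 := by fun_prop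
    have hlt : ∑ _a : ι, ψ 0 < ∑ a, ψ (φ a 0) :=
      (Finset.sum_nonpos fun _ _ => hψ0).trans_lt hpos
    exact (((hlim.eventually_lt_const hlt).filter_mono nhdsWithin_le_nhds).and
      (self_mem_nhdsWithin (s := Set.Ioi 0))).exists
  have hunit : ∀ᶠ t in 𝓝[>] (0 : ℝ), t ∈ Set.Ioo 0 1 := Ioo_mem_nhdsGT zero_lt_one
  obtain ⟨t, ⟨ht0, ht1⟩, ht⟩ := (hunit.and (eventually_all.2 fun a =>
    eventually_le_one_sub_mul_add (hφ a) (hneg a) hε0)).exists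
  refine ⟨t, ⟨ht0, ht1⟩, ?_⟩
  calc ∑ a, ψ (φ a t)
      ≤ ∑ a, ((1 - t) * ψ (φ a 0) + t * ψ ε) := Finset.sum_le_sum fun a _ =>
        (hmono (ht a)).trans (hconv.2 (Set.mem_univ _) (Set.mem_univ _)
          (sub_nonneg.2 ht1.le) ht0.le (sub_add_cancel 1 t))
    _ = (1 - t) * ∑ a, ψ (φ a 0) + t * ∑ _a : ι, ψ ε := by
        rw [Finset.sum_add_distrib, Finset.mul_sum, Finset.mul_sum]
    _ < ∑ a, ψ (φ a 0) := by linarith [mul_lt_mul_of_pos_left hε ht0]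

lemma exists_pos_linearization_of_isMinOn {ι : Type*} [Fintype ι] {ψ : ℝ → ℝ}
    (hmono : Monotone ψ) (hconv : ConvexOn ℝ Set.univ ψ) (hψ0 : ψ 0 ≤ 0) {S : Set F} {w v : F}
    (hS : StarConvex ℝ w S) {G : ι → F → ℝ} {G' : ι → F →L[ℝ] ℝ}
    (hG : ∀ a, HasFDerivAt (G a) (G' a) w) (hmin : IsMinOn (fun x => ∑ a, ψ (G a x)) S w)
    (hpos : 0 < ∑ a, ψ (G a w)) (hv : v ∈ S) : ∃ a, 0 < G a w + G' a (v - w) := by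
  by_contra! hneg
  have hderiv (a : ι) : HasDerivAt (fun t : ℝ => G a (w + t • (v - w))) (G' a (v - w)) 0 := by
    have hline : HasDerivAt (fun t : ℝ => w + t • (v - w)) (v - w) 0 := by
      simpa using ((hasDerivAt_id (0 : ℝ)).smul_const (v - w)).const_add w
    exact HasFDerivAt.comp_hasDerivAt 0 (by simpa using hG a) hline
  obtain ⟨t, ⟨ht0, ht1⟩, ht⟩ := exists_sum_comp_lt hmono hconv hψ0 hderiv
    (by simpa using hneg) (by simpa using hpos)
  simp only [zero_smul, add_zero] at ht
  exact (hmin (hS.add_smul_sub_mem hv ht0.le ht1.le)).not_gt ht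

end Calculus

lemma eventually_exists_lt_eq {β : Type*} [Finite β] (z : ℕ → β) :
    ∀ᶠ k in atTop, ∃ j < k, z j = z k := by
  have hvalue (b : β) : ∀ᶠ k in atTop, z k = b → ∃ j < k, z j = b := by
    by_cases hb : ∃ j, z j = b
    · obtain ⟨j, hj⟩ := hb
      filter_upwards [eventually_gt_atTop j] with k hk _ using ⟨j, hk, hj⟩
    · exact .of_forall fun k hk => (hb ⟨k, hk⟩).elim
  filter_upwards [eventually_all.2 hvalue] with k hk using hk _ rfl

lemma l0_le_sum_toNat {n : ℕ} {x : EuclideanSpace ℝ (Fin n)} {z : Fin n → Bool}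
    (hz : ∀ l, z l = false → x l = 0) : l0 x ≤ ∑ l, (z l).toNat := by
  rw [l0, Finset.card_filter]
  refine Finset.sum_le_sum fun l _ => ?_
  cases hl : z l
  · simp [hz l hl]
  · split_ifs <;> simp

namespace Problem

variable {N K n H p q : ℕ} {P : Problem N K n H p q}

section Relaxation

/-- Every master problem is a relaxation of `P₂`: each feasible `(x̃, ỹ)`, with a suitable `z` and
`α_i = f_i(x_i)`, is feasible for the master problem whatever the points that generate the cuts. -/
def MasterRelaxes (P : Problem N K n H p q) : Prop :=
  ∀ v ∈ P.consensusFeasible, ∃ z, ∀ w k, P.lift v z ∈ P.masterFeasible w k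

/-- The binary vectors that mark the nonzero entries of `y_1, …, y_K`. -/
noncomputable def supportPattern (y : Fin K → EuclideanSpace ℝ (Fin n)) : Binary K n :=
  fun j l => decide (y j l ≠ 0)

lemma cardOK_supportPattern_iff {y : Fin K → EuclideanSpace ℝ (Fin n)} :
    P.CardOK (supportPattern y) ↔ ∀ j, l0 (y j) ≤ P.κ := by
  have hsum (j : Fin K) : ∑ l, (supportPattern y j l).toNat = l0 (y j) := by
    simp only [supportPattern, l0, Finset.card_filter, Bool.toNat, Bool.cond_decide]
  simp only [CardOK, hsum]

lemma soCut_le {i : Fin N} (hf : IsStronglyConvex (P.μ i) (P.f i))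
    (c x : EuclideanSpace ℝ (Fin n)) : P.soCut i c x ≤ P.f i x := by
  obtain ⟨-, hdiff, hdiff', hhess⟩ := hf
  rw [soCut, inner_gradient_left]
  exact add_fderiv_add_sq_le_of_le_fderiv_fderiv hdiff hdiff' hhess c x

lemma linearization_le {h : Fin H} (hg : Differentiable ℝ (P.g h))
    (hconv : ConvexOn ℝ Set.univ (P.g h)) (c x : EuclideanSpace ℝ (Fin n)) :
    P.g h c + inner ℝ (gradient (P.g h) c) (x - c) ≤ P.g h x := by
  rw [inner_gradient_left]
  exact add_hasFDerivAt_le_of_convexOn hconv (Set.mem_univ c) (Set.mem_univ x) (hg c).hasFDerivAt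

lemma satisfiesCuts_lift (hf : ∀ i, IsStronglyConvex (P.μ i) (P.f i))
    (hg : ∀ h, Differentiable ℝ (P.g h)) (hconv : ∀ h, ConvexOn ℝ Set.univ (P.g h))
    {v : Point N K n} (hv : ∀ i h, P.g h (v.1 i) ≤ 0) (c : Fin N → EuclideanSpace ℝ (Fin n))
    (z : Binary K n) : P.SatisfiesCuts c (P.lift v z) := by
  have hlin (i h) : P.g h (c i) + inner ℝ (gradient (P.g h) (c i)) (v.1 i - c i) ≤ 0 :=
    (linearization_le (hg h) (hconv h) _ _).trans (hv i h)
  refine ⟨fun i _ => soCut_le (hf i) _ _, fun i h _ _ hactive => ?_, fun _ => hlin⟩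
  simpa only [lift, hactive, zero_add] using hlin i h

lemma mem_linearFeasible_supportPattern (hE : ∀ j, (P.E j).Nonempty)
    (hM : ∀ j, ∀ x ∈ P.scpFeasible, ∀ l, |x l| ≤ P.M j) {v : Point N K n}
    (hv : v ∈ P.consensusFeasible) : v ∈ P.linearFeasible (supportPattern v.2) := by
  obtain ⟨hvg, hvc, hvΩ, hvκ⟩ := hv
  refine ⟨hvc, hvΩ, fun j l => ?_⟩
  obtain ⟨i, hi⟩ := hE j
  have hfeas : v.2 j ∈ P.scpFeasible := ⟨hvc j i hi ▸ ⟨hvΩ i, hvg i⟩, hvκ j⟩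
  by_cases h0 : v.2 j l = 0
  · simp [supportPattern, h0]
  · simpa [supportPattern, h0] using abs_le.1 (hM j _ hfeas l)

lemma masterRelaxes (hf : ∀ i, IsStronglyConvex (P.μ i) (P.f i))
    (hg : ∀ h, Differentiable ℝ (P.g h)) (hconv : ∀ h, ConvexOn ℝ Set.univ (P.g h))
    (hE : ∀ j, (P.E j).Nonempty) (hM : ∀ j, ∀ x ∈ P.scpFeasible, ∀ l, |x l| ≤ P.M j) :
    P.MasterRelaxes := fun v hv =>
  ⟨supportPattern v.2, fun w _ =>
    ⟨fun ℓ _ => satisfiesCuts_lift hf hg hconv hv.1 (w ℓ).1 _,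
      mem_linearFeasible_supportPattern hE hM hv, cardOK_supportPattern_iff.2 hv.2.2.2⟩⟩

lemma diagonal_mem_consensusFeasible {x : EuclideanSpace ℝ (Fin n)} (hx : x ∈ P.scpFeasible) :
    ((fun _ => x, fun _ => x) : Point N K n) ∈ P.consensusFeasible :=
  ⟨fun _ => hx.1.2, fun _ _ _ => rfl, fun _ => hx.1.1, fun _ => hx.2⟩

lemma primalFeasible_subset_consensusFeasible {z : Binary K n} (hz : P.CardOK z) :
    P.primalFeasible z ⊆ P.consensusFeasible := by
  rintro w ⟨⟨hwc, hwΩ, hwM⟩, hwg⟩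
  refine ⟨hwg, hwc, hwΩ, fun j => (l0_le_sum_toNat fun l hl => ?_).trans (hz j)⟩
  have hbounds := hwM j l
  simp only [hl, Bool.toNat_false, Nat.cast_zero, mul_zero, neg_zero] at hbounds
  exact le_antisymm hbounds.2 hbounds.1

variable {c : ℕ → Point N K n} {k : ℕ} {v w : Point N K n} {z : Binary K n}

lemma IsMasterOptimal.sum_le_objective (hP : P.MasterRelaxes) {s : MasterPoint N K n}
    (hs : P.IsMasterOptimal c k s) (hv : v ∈ P.consensusFeasible) :
    ∑ i, s.α i ≤ P.objective v := by
  obtain ⟨z', hz'⟩ := hP v hv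
  exact hs.2 (hz' c k)

lemma IsMasterOptimal.isOptimal_of_lift (hP : P.MasterRelaxes)
    (hw : P.IsMasterOptimal c k (P.lift w z)) (hfeas : w ∈ P.consensusFeasible) :
    IsOptimal P.objective P.consensusFeasible w :=
  ⟨hfeas, fun _ hv => hw.sum_le_objective hP hv⟩

lemma IsMasterOptimal.exists_lift_of_isOptimal (hP : P.MasterRelaxes)
    (hw : P.IsMasterOptimal c k (P.lift w z)) (hfeas : w ∈ P.consensusFeasible)
    (hv : IsOptimal P.objective P.consensusFeasible v) :
    ∃ z', P.IsMasterOptimal c k (P.lift v z') := by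
  obtain ⟨z', hz'⟩ := hP v hv.1
  have hvw : P.objective v ≤ P.objective w := hv.2 hfeas
  exact ⟨z', hz' c k, fun _ hs => hvw.trans (hw.2 hs)⟩

end Relaxation

section OptimalityCuts

variable {z : Binary K n} {w : Point N K n} {s : MasterPoint N K n}

/-- The projection `(x̃, ỹ) ↦ x_i`. -/
def nodeProj (K n : ℕ) (i : Fin N) : Point N K n →L[ℝ] EuclideanSpace ℝ (Fin n) :=
  .comp (.proj i) (.fst ℝ _ _)

lemma hasFDerivAt_comp_node {φ : EuclideanSpace ℝ (Fin n) → ℝ} {i : Fin N}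
    (hφ : DifferentiableAt ℝ φ (w.1 i)) :
    HasFDerivAt (fun w' : Point N K n => φ (w'.1 i))
      ((fderiv ℝ φ (w.1 i)).comp (nodeProj K n i)) w :=
  hφ.hasFDerivAt.comp w (nodeProj K n i).hasFDerivAt

lemma Consensus.eq_of_fst_eq (hE : ∀ j, (P.E j).Nonempty) {v : Point N K n} (hv : P.Consensus v)
    (hw : P.Consensus w) (hvw : v.1 = w.1) : v = w := by
  refine Prod.ext hvw (funext fun j => ?_)
  obtain ⟨i, hi⟩ := hE j
  rw [← hv j i hi, ← hw j i hi, hvw]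

lemma sum_inner_gradient_nonneg_of_isOptimal (hf : ∀ i, Differentiable ℝ (P.f i))
    (hw : IsOptimal P.objective (P.primalFeasible z) w) {e : Point N K n}
    (he : e ∈ posTangentConeAt (P.primalFeasible z) w) :
    0 ≤ ∑ i, inner ℝ (gradient (P.f i) (w.1 i)) (e.1 i) := by
  have hderiv : HasFDerivAt P.objective _ w :=
    .fun_sum fun i _ => hasFDerivAt_comp_node (hf i (w.1 i))
  have hnonneg := hw.2.localize.hasFDerivWithinAt_nonneg hderiv.hasFDerivWithinAt he
  simpa [nodeProj, sum_apply, inner_gradient_left] using hnonneg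

lemma sub_mem_linearizedCone (hw : w ∈ P.primalFeasible z) (hs : s.pt ∈ P.linearFeasible z)
    (hcut : P.SatisfiesCuts w.1 s) : s.pt - w ∈ P.linearizedCone z w := by
  obtain ⟨⟨hwc, hwΩ, -⟩, hwg⟩ := hw
  obtain ⟨hsc, hsΩ, hsM⟩ := hs
  refine ⟨fun i h hactive => ?_, fun j i hi => ?_, fun i r hr => ?_, fun i => ?_,
    fun j l => ⟨fun hup => ?_, fun hlow => ?_⟩⟩
  · have hX : w.1 i ∈ P.X := ⟨hwΩ i, hwg i⟩
    -- No cut is generated at interior points, but there an active constraint has zero gradient.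
    by_cases hint : w.1 i ∈ interior P.X
    · have hzero := fderiv_eq_zero_of_nonpos_of_mem_interior (fun u hu => hu.2 h) hint hactive
      simp [inner_gradient_left, hzero]
    · exact hcut.2.1 i h hX ⟨subset_closure hX, hint⟩ hactive
  · simp [hsc j i hi, hwc j i hi]
  · simpa [Matrix.mulVec_sub, hr] using (hsΩ i).1 r
  · simp [Matrix.mulVec_sub, (hsΩ i).2, (hwΩ i).2]
  · simpa [hup] using (hsM j l).2
  · simpa [hlow, neg_le_iff_add_nonneg] using (hsM j l).1

lemma objective_add_sum_sq_le_of_satisfiesCuts (hf : ∀ i, Differentiable ℝ (P.f i))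
    (hw : IsOptimal P.objective (P.primalFeasible z) w) (hCQ : P.ConstraintQualification z w)
    (hs : s.pt ∈ P.linearFeasible z) (hcut : P.SatisfiesCuts w.1 s) :
    P.objective w + ∑ i, P.μ i / 2 * ‖s.pt.1 i - w.1 i‖ ^ 2 ≤ ∑ i, s.α i := by
  have hfirst := sum_inner_gradient_nonneg_of_isOptimal hf hw
    (hCQ (sub_mem_linearizedCone hw.1 hs hcut))
  simp only [Prod.fst_sub, Pi.sub_apply] at hfirst
  calc P.objective w + ∑ i, P.μ i / 2 * ‖s.pt.1 i - w.1 i‖ ^ 2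
      ≤ ∑ i, P.soCut i (w.1 i) (s.pt.1 i) := by
        simp only [soCut, Finset.sum_add_distrib, objective]
        linarith
    _ ≤ ∑ i, s.α i := Finset.sum_le_sum fun i _ => hcut.1 i ⟨hw.1.1.2.1 i, hw.1.2 i⟩

lemma eq_lift_of_sum_le_objective (hf : ∀ i, Differentiable ℝ (P.f i)) (hμ : ∀ i, 0 < P.μ i)
    (hE : ∀ j, (P.E j).Nonempty) (hw : IsOptimal P.objective (P.primalFeasible z) w)
    (hCQ : P.ConstraintQualification z w) (hs : s.pt ∈ P.linearFeasible z)
    (hcut : P.SatisfiesCuts w.1 s) (hle : ∑ i, s.α i ≤ P.objective w) : s = P.lift w s.z := by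
  have hgrowth := objective_add_sum_sq_le_of_satisfiesCuts hf hw hCQ hs hcut
  have hquad (i) : 0 ≤ P.μ i / 2 * ‖s.pt.1 i - w.1 i‖ ^ 2 :=
    mul_nonneg (half_pos (hμ i)).le (sq_nonneg _)
  have hsum : ∑ i, P.μ i / 2 * ‖s.pt.1 i - w.1 i‖ ^ 2 = 0 :=
    le_antisymm (by linarith) (Finset.sum_nonneg fun i _ => hquad i)
  have hx : s.pt.1 = w.1 := funext fun i => by
    have hi := (Finset.sum_eq_zero_iff_of_nonneg fun i _ => hquad i).1 hsum i (Finset.mem_univ i)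
    simpa [(hμ i).ne', sub_eq_zero] using hi
  have hle_α (i) : P.f i (w.1 i) ≤ s.α i := by
    simpa [soCut, hx] using hcut.1 i ⟨hw.1.1.2.1 i, hw.1.2 i⟩
  have hα (i) : P.f i (w.1 i) = s.α i :=
    (Finset.sum_eq_sum_iff_of_le fun i _ => hle_α i).1
      ((Finset.sum_le_sum fun i _ => hle_α i).antisymm hle) i (Finset.mem_univ i)
  have hpt : s.pt = w := Consensus.eq_of_fst_eq hE hs.1 hw.1.1.1 hx
  obtain ⟨α, pt, z'⟩ := s
  exact congrArg₂ (MasterPoint.mk · · z') (funext fun i => (hα i).symm) hpt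

end OptimalityCuts

section FeasibilityCuts

lemma convex_Ω : Convex ℝ P.Ω := by
  let ofLp := (WithLp.linearEquiv 2 ℝ (Fin n → ℝ)).toLinearMap
  exact ((convex_Iic P.d).linear_preimage (P.D.mulVecLin ∘ₗ ofLp)).inter
    ((convex_singleton P.b).linear_preimage (P.A.mulVecLin ∘ₗ ofLp))

lemma convex_linearFeasible (z : Binary K n) : Convex ℝ (P.linearFeasible z) := by
  rintro x ⟨hxc, hxΩ, hxM⟩ y ⟨hyc, hyΩ, hyM⟩ a b ha hb hab
  refine ⟨fun j i hi => ?_, fun i => convex_Ω (hxΩ i) (hyΩ i) ha hb hab, fun j l => ?_⟩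
  · simp [hxc j i hi, hyc j i hi]
  · exact convex_Icc (-(P.M j * ((z j l).toNat : ℝ))) (P.M j * ((z j l).toNat : ℝ))
      (hxM j l) (hyM j l) ha hb hab

variable {z : Binary K n} {w v : Point N K n}

lemma exists_pos_linearization_of_isOptimal (hg : ∀ h, Differentiable ℝ (P.g h)) {ψ : ℝ → ℝ}
    (hmono : Monotone ψ) (hconv : ConvexOn ℝ Set.univ ψ) (hψ0 : ψ 0 ≤ 0)
    (hw : IsOptimal (fun w' : Point N K n => ∑ i, ∑ h, ψ (P.g h (w'.1 i))) (P.linearFeasible z) w)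
    (hpos : 0 < ∑ i, ∑ h, ψ (P.g h (w.1 i))) (hv : v ∈ P.linearFeasible z) :
    ∃ i h, 0 < P.g h (w.1 i) + inner ℝ (gradient (P.g h) (w.1 i)) (v.1 i - w.1 i) := by
  simp only [← Fintype.sum_prod_type'] at hw hpos
  obtain ⟨⟨i, h⟩, hih⟩ := exists_pos_linearization_of_isMinOn hmono hconv hψ0
    ((convex_linearFeasible z).starConvex hw.1)
    (fun a : Fin N × Fin H => hasFDerivAt_comp_node (hg a.2 (w.1 a.1))) hw.2 hpos hv
  exact ⟨i, h, by rwa [inner_gradient_left]⟩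

lemma IsInfeasibilityPoint.not_satisfiesCuts (hg : ∀ h, Differentiable ℝ (P.g h))
    (hw : P.IsInfeasibilityPoint z w) (hz : ¬ (P.primalFeasible z).Nonempty)
    {s : MasterPoint N K n} (hs : s.pt ∈ P.linearFeasible z) : ¬ P.SatisfiesCuts w.1 s := by
  intro hcut
  have hmem : w ∈ P.linearFeasible z := hw.elim (fun h => h.1.1) fun h => h.1
  obtain ⟨i, h, hviol⟩ : ∃ i h, 0 < P.g h (w.1 i) := by
    by_contra! hnonpos
    exact hz ⟨w, hmem, hnonpos⟩
  have hnonpos := hcut.2.2 ⟨i, fun hX => (hX.2 h).not_gt hviol⟩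
  suffices ∃ i h, 0 < P.g h (w.1 i) + inner ℝ (gradient (P.g h) (w.1 i)) (s.pt.1 i - w.1 i) by
    obtain ⟨i, h, hpos⟩ := this
    exact (hnonpos i h).not_gt hpos
  rcases hw with ⟨hmin, hsum⟩ | hmin
  · exact exists_pos_linearization_of_isOptimal hg monotone_id (convexOn_id convex_univ) le_rfl
      hmin hsum hs
  · have hnonneg (i h) : 0 ≤ max (P.g h (w.1 i)) 0 := le_max_right _ _
    have hsum : 0 < ∑ i, ∑ h, max (P.g h (w.1 i)) 0 :=
      Finset.sum_pos' (fun i _ => Finset.sum_nonneg fun h _ => hnonneg i h)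
        ⟨i, Finset.mem_univ i, Finset.sum_pos' (fun h _ => hnonneg i h)
          ⟨h, Finset.mem_univ h, lt_max_of_lt_left hviol⟩⟩
    exact exists_pos_linearization_of_isOptimal hg (monotone_id.max monotone_const)
      ((convexOn_id convex_univ).sup (convexOn_const 0 convex_univ)) (max_self 0).le hmin hsum hs

end FeasibilityCuts

namespace IsRun

variable {z : ℕ → Binary K n} {w : ℕ → Point N K n} {s : ℕ → MasterPoint N K n}

lemma cardOK (hrun : P.IsRun z w s) : ∀ k, P.CardOK (z k)
  | 0 => hrun.card_init
  | k + 1 => hrun.binary k ▸ (hrun.master k).1.2.2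

lemma exists_eq_lift_of_repeat (hrun : P.IsRun z w s) (hP : P.MasterRelaxes)
    (hf : ∀ i, Differentiable ℝ (P.f i)) (hμ : ∀ i, 0 < P.μ i)
    (hg : ∀ h, Differentiable ℝ (P.g h)) (hE : ∀ j, (P.E j).Nonempty)
    (hCQ : ∀ z, P.CardOK z → ∀ w,
      IsOptimal P.objective (P.primalFeasible z) w → P.ConstraintQualification z w)
    {j k : ℕ} (hjk : j ≤ k) (hz : z j = z (k + 1)) :
    ∃ v ∈ P.consensusFeasible, s (k + 1) = P.lift v (z (k + 1)) := by
  have hmaster := hrun.master k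
  have hcut : P.SatisfiesCuts (w (j + 1)).1 (s (k + 1)) :=
    hmaster.1.1 (j + 1) (Finset.mem_Icc.2 ⟨by omega, by omega⟩)
  have hlin : (s (k + 1)).pt ∈ P.linearFeasible (z j) := by
    rw [hz, hrun.binary k]
    exact hmaster.1.2.1
  have hfeas : (P.primalFeasible (z j)).Nonempty := by
    by_contra hempty
    exact (hrun.infeasible j hempty).not_satisfiesCuts hg hempty hlin hcut
  have hopt := hrun.primal j hfeas
  have hcons := primalFeasible_subset_consensusFeasible (hrun.cardOK j) hopt.1
  refine ⟨w (j + 1), hcons, hrun.binary k ▸ ?_⟩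
  exact eq_lift_of_sum_le_objective hf hμ hE hopt (hCQ _ (hrun.cardOK j) _ hopt) hlin hcut
    (hmaster.sum_le_objective hP hcons)

end IsRun

end Problem

end DiPOA

open DiPOA Problem in
theorem mainTheorem2_general {N K n H p q : ℕ} (P : DiPOA.Problem N K n H p q)
    (hf : ∀ i, IsStronglyConvex (P.μ i) (P.f i))
    (hg : ∀ h, Differentiable ℝ (P.g h))
    (hg_convex : ∀ h, ConvexOn ℝ Set.univ (P.g h))
    (hE : ∀ j, (P.E j).Nonempty)
    (hM : ∀ j, ∀ x ∈ P.scpFeasible, ∀ l, |x l| ≤ P.M j)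
    (hCQ : ∀ z, P.CardOK z → ∀ w,
      IsOptimal P.objective (P.primalFeasible z) w → P.ConstraintQualification z w) :
    (∀ i c x, P.soCut i c x ≤ P.f i x) ∧
    (∀ x ∈ P.scpFeasible, ∃ z, ∀ w k,
      P.lift (fun _ => x, fun _ => x) z ∈ P.masterFeasible w k) ∧
    (∀ v ∈ P.consensusFeasible, ∃ z, ∀ w k, P.lift v z ∈ P.masterFeasible w k) ∧
    (∀ z w s, P.IsRun z w s → ∃ kstar : ℕ, ∀ k ≥ kstar,
      IsOptimal P.objective P.consensusFeasible (s k).pt ∧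
      (∀ i, (s k).α i = P.f i ((s k).pt.1 i)) ∧
      ∀ v, IsOptimal P.objective P.consensusFeasible v →
        ∃ z', P.IsMasterOptimal w k (P.lift v z')) := by
  have hP : P.MasterRelaxes := masterRelaxes hf hg hg_convex hE hM
  refine ⟨fun i => soCut_le (hf i), fun x hx => hP _ (diagonal_mem_consensusFeasible hx), hP,
    fun z w s hrun => ?_⟩
  obtain ⟨kstar, hrepeat⟩ := Filter.eventually_atTop.1 (eventually_exists_lt_eq z)
  refine ⟨kstar, fun k hk => ?_⟩
  obtain ⟨j, hjk, hz⟩ := hrepeat k hk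
  obtain ⟨k, rfl⟩ := Nat.exists_eq_add_one.2 (Nat.zero_lt_of_lt hjk)
  obtain ⟨v, hv, hlift⟩ := hrun.exists_eq_lift_of_repeat hP (fun i => (hf i).2.1)
    (fun i => (hf i).1) hg hE hCQ (Nat.le_of_lt_succ hjk) hz
  have hmaster := hrun.master k
  rw [hlift] at hmaster ⊢
  exact ⟨hmaster.isOptimal_of_lift hP hv, fun _ => rfl,
    fun _ => hmaster.exists_lift_of_isOptimal hP hv⟩

theorem mainTheorem2 {N K n H p q : ℕ} (P : DiPOA.Problem N K n H p q)
    (hf : ∀ i, DiPOA.IsStronglyConvex (P.μ i) (P.f i))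
    (hg_smooth : ∀ h, ContDiff ℝ 1 (P.g h))
    (hg_convex : ∀ h, ConvexOn ℝ Set.univ (P.g h))
    (hΩ : Bornology.IsBounded P.Ω)
    (hE : ∀ j, (P.E j).Nonempty)
    (hM : ∀ j, ∀ x ∈ P.Ω, ∀ l, |x l| ≤ P.M j)
    (hCQ : ∀ z, P.CardOK z → ∀ w,
      DiPOA.IsOptimal P.objective (P.primalFeasible z) w → P.ConstraintQualification z w) :
    -- the quadratic cuts are global underestimators
    (∀ i c x, P.soCut i c x ≤ P.f i x) ∧
    -- no feasible point of the sparse convex program, or of its consensus form, is cut off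
    (∀ x ∈ P.scpFeasible, ∃ z, ∀ w k,
      P.lift (fun _ => x, fun _ => x) z ∈ P.masterFeasible w k) ∧
    (∀ v ∈ P.consensusFeasible, ∃ z, ∀ w k, P.lift v z ∈ P.masterFeasible w k) ∧
    -- finite convergence
    (∀ z w s, P.IsRun z w s → ∃ kstar : ℕ, ∀ k ≥ kstar,
      DiPOA.IsOptimal P.objective P.consensusFeasible (s k).pt ∧
      (∀ i, (s k).α i = P.f i ((s k).pt.1 i)) ∧
      ∀ v, DiPOA.IsOptimal P.objective P.consensusFeasible v →
        ∃ z', P.IsMasterOptimal w k (P.lift v z')) :=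
  mainTheorem2_general P hf (fun h => (hg_smooth h).differentiable one_ne_zero) hg_convex hE
    (fun j x hx => hM j x hx.1.1) hCQ
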